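/- Let $d,d',a,t$ be positive integers. For $Q,K\in\mathbb{R}^{a\times d}$ and $V\in\mathbb{R}^{d'\times d}$, let $$\varphi_{(Q,K,V)}\colon \mathbb{R}^{d\times t}\to\mathbb{R}^{d'\times t},\qquad (x_i)_{1\le i\le t}\mapsto\Big(\sum_{1\le j\le t} x_j^\top (K^\top Q)\,x_i\; V x_j\Big)_{1\le i\le t},$$ that is, $\varphi_{(Q,K,V)}(X)=VXX^\top K^\top QX$, be the single-layer lightning self-attention mechanism, where $x_1,\dots,x_t\in\mathbb{R}^d$ are the columns of $X$. Let $$\mathcal{M}_{d,d',a}=\{\varphi_{(Q,K,V)} \mid Q,K\in\mathbb{R}^{a\times d},\ V\in\mathbb{R}^{d'\times d}\}\subset \mathrm{Sym}_3(\mathbb{R}^{d\times t},\mathbb{R}^{d'\times t})$$ be its neuromanifold, where $\mathrm{Sym}_3(\mathbb{R}^{d\times t},\mathbb{R}^{d'\times t})$ is the finite-dimensional real vector space of maps all of whose output coordinates are homogeneous polynomials of degree $3$ in the entries of the input. The dimension of a subset $S$ of a finite-dimensional real vector space $E$ is understood in the sense of algebraic geometry: it is the dimension of the Zariski closure of $S$,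 i.e. the Krull dimension of the ring of restrictions to $S$ of polynomial functions on $E$. Suppose that $t\ge 2$ and that $d,d'\ge 2$ or $d,a\ge 2$. Then $$\dim(\mathcal{M}_{d,d',a})=\begin{cases}2ad+dd'-a^2-1 & \text{if } a\le d,\\ d^2+dd'-1 & \text{otherwise.}\end{cases}$$ -/

import Mathlib

open Matrix

namespace LightningAttention

/-- The lightning self-attention mechanism with query, key and value weights `Q`, `K`, `V`.
The columns of `X` are the tokens `x_j`, and the `i`-th column of the output is
`∑ j, (x_jᵀ (Kᵀ Q) x_i) • V x_j`. -/
def mechanism {d d' a t : ℕ} (Q K : Matrix (Fin a) (Fin d) ℝ) (V : Matrix (Fin d') (Fin d) ℝ)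
    (X : Matrix (Fin d) (Fin t) ℝ) : Matrix (Fin d') (Fin t) ℝ :=
  Matrix.of fun r i =>
    ∑ j, (X.col j ⬝ᵥ ((Kᵀ * Q) *ᵥ X.col i)) * (V *ᵥ X.col j) r

/-- The matrix form of the mechanism. -/
theorem mechanism_eq_mul {d d' a t : ℕ} (Q K : Matrix (Fin a) (Fin d) ℝ)
    (V : Matrix (Fin d') (Fin d) ℝ) (X : Matrix (Fin d) (Fin t) ℝ) :
    mechanism Q K V X = V * X * Xᵀ * Kᵀ * Q * X := by
  have h : V * X * Xᵀ * Kᵀ * Q * X = (V * X) * (Xᵀ * ((Kᵀ * Q) * X)) := by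
    simp only [Matrix.mul_assoc]
  rw [h]
  ext r i
  rw [Matrix.mul_apply]
  simp only [mechanism, Matrix.of_apply]
  refine Finset.sum_congr rfl fun j _ => ?_
  rw [mul_comm]
  rfl

/-- The vector space of homogeneous polynomial maps of degree `n` from `d × t` matrices to
`d' × t` matrices: every output entry is a homogeneous polynomial of degree `n` in the entries of
the input. -/
def homogeneousMaps (n d d' t : ℕ) :
    Submodule ℝ (Matrix (Fin d) (Fin t) ℝ → Matrix (Fin d') (Fin t) ℝ) where
  carrier := {f | ∀ r i, ∃ p : MvPolynomial (Fin d × Fin t) ℝ, p.IsHomogeneous n ∧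
    ∀ X, f X r i = MvPolynomial.eval (fun k => X k.1 k.2) p}
  add_mem' := by
    intro f g hf hg r i
    obtain ⟨p, hp, hfp⟩ := hf r i
    obtain ⟨q, hq, hgq⟩ := hg r i
    exact ⟨p + q, hp.add hq, fun X => by simp [hfp, hgq]⟩
  zero_mem' := fun r i => ⟨0, MvPolynomial.isHomogeneous_zero _ _ _, fun X => by simp⟩
  smul_mem' := by
    intro c f hf r i
    obtain ⟨p, hp, hfp⟩ := hf r i
    refine ⟨MvPolynomial.C c * p, ?_, fun X => by simp [hfp]⟩
    simpa using (MvPolynomial.isHomogeneous_C (Fin d × Fin t) c).mul hp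

/-- The mechanism is cubical and homogeneous in its input. -/
theorem mechanism_mem {d d' a t : ℕ} (Q K : Matrix (Fin a) (Fin d) ℝ)
    (V : Matrix (Fin d') (Fin d) ℝ) :
    (mechanism Q K V : Matrix (Fin d) (Fin t) ℝ → Matrix (Fin d') (Fin t) ℝ) ∈
      homogeneousMaps 3 d d' t := by
  intro r i
  refine ⟨∑ j, (∑ k, MvPolynomial.X (k, j) *
      (∑ l, MvPolynomial.C ((Kᵀ * Q) k l) * MvPolynomial.X (l, i))) *
      (∑ m, MvPolynomial.C (V r m) * MvPolynomial.X (m, j)), ?_, fun X => ?_⟩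
  · have hlin : ∀ (c : Fin d → ℝ) (j : Fin t),
        (∑ l, MvPolynomial.C (c l) * MvPolynomial.X (l, j) :
          MvPolynomial (Fin d × Fin t) ℝ).IsHomogeneous 1 := fun c j =>
      MvPolynomial.IsHomogeneous.sum _ _ _ fun l _ => by
        simpa using (MvPolynomial.isHomogeneous_C (Fin d × Fin t) (c l)).mul
          (MvPolynomial.isHomogeneous_X ℝ (l, j))
    refine MvPolynomial.IsHomogeneous.sum _ _ _ fun j _ => ?_
    refine MvPolynomial.IsHomogeneous.mul (m := 2) (n := 1) ?_ (hlin _ j)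
    refine MvPolynomial.IsHomogeneous.sum _ _ _ fun k _ => ?_
    exact (MvPolynomial.isHomogeneous_X ℝ (k, j)).mul (hlin _ i)
  · simp [mechanism, dotProduct, mulVec, Matrix.col_apply]

/-- The neuromanifold of a single layer: the image of the parametrization
`(Q, K, V) ↦ mechanism Q K V`, as a subset of the space of homogeneous cubical maps. -/
def neuromanifold (d d' a t : ℕ) : Set (homogeneousMaps 3 d d' t) :=
  Set.range fun W : Matrix (Fin a) (Fin d) ℝ × Matrix (Fin a) (Fin d) ℝ ×
      Matrix (Fin d') (Fin d) ℝ =>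
    ⟨mechanism W.1 W.2.1 W.2.2, mechanism_mem W.1 W.2.1 W.2.2⟩

/-- The coordinate ring of a subset `S` of a finite-dimensional real vector space `E`: the ring of
restrictions to `S` of polynomial functions on `E`, that is, the algebra generated by the
restrictions of the linear forms. It is the quotient of the ring of polynomials on `E` by the ideal
of the polynomials that vanish on `S`. -/
def coordinateRing {E : Type*} [AddCommGroup E] [Module ℝ E] (S : Set E) : Subalgebra ℝ (S → ℝ) :=
  Algebra.adjoin ℝ (Set.range fun (l : Module.Dual ℝ E) (s : S) => l s)

/-- The dimension, in the sense of real algebraic geometry, of a (semi-algebraic) subset `S` of a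
finite-dimensional real vector space: the Krull dimension of the coordinate ring of `S`,
equivalently of the Zariski closure of `S`. -/
noncomputable def dimension {E : Type*} [AddCommGroup E] [Module ℝ E] (S : Set E) : WithBot ℕ∞ :=
  ringKrullDim (coordinateRing S)

end LightningAttention

/-!
The dimension is the transcendence degree of the coordinate ring of the neuromanifold, and it is
computed from a slice of the weight space on which the parametrization is dominant and generically
finite.

For `a ≥ d` the matrix `A = Kᵀ * Q` is arbitrary, as it is for `a = d` (`neuromanifold_eq_of_le`), so
let `a ≤ d`. The mechanism depends on the weights only through `A ⊗ V`. The change of basis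
`(Q, K) ↦ (G⁻¹ Q, Gᵀ K)` and a scaling bring generic weights into the slice where `Q = [1 | *]` and one
fixed entry of `V` is `1`; this slice has `2ad - a² + dd' - 1` free parameters. As generic weights can
be moved into the slice, the pullback from the coordinate ring to the polynomial ring in these
parameters is injective (`slice_pullback_injective`).

Conversely, the parameters are algebraic over the coordinate ring (`isAlgebraic_slice`). Two tokens
`x`, `y` suffice to extract `(yᵀ A x) (V y)_r` from the mechanism by a linear form. For `x = e_l` this is,
as a quadratic form in `y`, the product of the linear forms given by a row of `V` and a column of `A`,
and the two factors are found by solving a quadratic equation (`isAlgebraic_of_mul_mem`). This also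
covers the case where the form can be factored with the factors exchanged, because finiteness of the
fibre is all that matters. Finally `Kᵀ` is part of `A`, and `Q` is recovered from `A` by Cramer's rule.

So the polynomial ring is algebraic over a finitely generated subalgebra isomorphic to the coordinate
ring, whose Krull dimension is therefore the number of parameters
(`ringKrullDim_eq_card_of_isAlgebraic`).
-/

namespace LightningAttention

/-! ### Krull dimension and transcendence degree -/

/-- An injective integral extension preserves the Krull dimension: chains of primes lift by going
up, and distinct comparable primes stay distinct after contraction. -/
theorem ringKrullDim_eq_of_isIntegral (R S : Type*) [CommRing R] [CommRing S] [Algebra R S]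
    [FaithfulSMul R S] [Algebra.IsIntegral R S] : ringKrullDim R = ringKrullDim S := by
  apply le_antisymm
  · refine iSup_le fun l => ?_
    obtain ⟨⟨P, hP, hPo⟩⟩ := Ideal.nonempty_primesOver (S := S) l.head.asIdeal
    have := hPo
    obtain ⟨L, hL, -⟩ := Ideal.exists_ltSeries_of_hasGoingUp (S := S) l P
    rw [← hL]
    exact Order.LTSeries.length_le_krullDim L
  · refine Order.krullDim_le_of_strictMono (PrimeSpectrum.comap (algebraMap R S)) ?_
    intro I J h
    exact Ideal.IsIntegral.comap_lt_comap (R := R) h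

/-- For a finitely generated domain over a field, the Krull dimension is the transcendence degree:
both can be read off from a Noether normalization. -/
theorem ringKrullDim_eq_of_trdeg_eq (k A : Type*) [Field k] [CommRing A] [IsDomain A] [Algebra k A]
    [Algebra.FiniteType k A] {n : ℕ} (h : Algebra.trdeg k A = n) : ringKrullDim A = n := by
  obtain ⟨s, g, hg, hint⟩ := exists_integral_inj_algHom_of_fg k A
  algebraize [g.toRingHom]
  have : FaithfulSMul (MvPolynomial (Fin s) k) A := (faithfulSMul_iff_algebraMap_injective _ _).2 hg
  have : IsScalarTower k (MvPolynomial (Fin s) k) A :=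
    IsScalarTower.of_algebraMap_eq fun x => (g.commutes x).symm
  have h2 := lift_trdeg_add_eq k (MvPolynomial (Fin s) k) A
  rw [trdeg_eq_zero (R := MvPolynomial (Fin s) k), h] at h2
  simp at h2
  rw [← ringKrullDim_eq_of_isIntegral (MvPolynomial (Fin s) k) A,
    MvPolynomial.ringKrullDim_of_isNoetherianRing]
  simp [h2]

/-- A finitely generated subalgebra over which the ambient polynomial ring is algebraic has as many
dimensions as there are variables. -/
theorem ringKrullDim_eq_card_of_isAlgebraic {k σ : Type*} [Field k] [Finite σ]
    (R : Subalgebra k (MvPolynomial σ k)) [Algebra.FiniteType k R]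
    [Algebra.IsAlgebraic R (MvPolynomial σ k)] : ringKrullDim R = Nat.card σ := by
  refine ringKrullDim_eq_of_trdeg_eq k R ?_
  have h := lift_trdeg_add_eq k R (MvPolynomial σ k)
  have := Fintype.ofFinite σ
  rw [trdeg_eq_zero (R := R), MvPolynomial.trdeg_of_isDomain] at h
  simpa using h

/-! ### Recovering factors from products -/

theorem isAlgebraic_of_quadratic {R T : Type*} [CommRing R] [CommRing T] [Algebra R T] {p s q : R}
    {z : T} (hp : p ≠ 0)
    (h : algebraMap R T p * z ^ 2 - algebraMap R T s * z + algebraMap R T q = 0) :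
    IsAlgebraic R z := by
  refine ⟨.C p * .X ^ 2 - .C s * .X + .C q, fun h0 => hp ?_, by simpa using h⟩
  simpa [Polynomial.coeff_X, Polynomial.coeff_C] using congrArg (Polynomial.coeff · 2) h0

/-- The generic fibre of the parametrization is finite. Write `v` for a row of `V` and `α` for a
column of `A`; the hypotheses say that `R` contains the coefficients of the quadratic forms
`(∑ i, v i * x i) * (∑ i, α i * x i)` that involve the variable `x i₀` or are diagonal. After the
normalization `V r₀ i₀ = 1`, these determine all factors up to finitely many choices. -/
theorem isAlgebraic_of_mul_mem {k T : Type*} [Field k] [CommRing T] [IsDomain T] [Algebra k T]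
    (R : Subalgebra k T) {ι κ μ : Type*} (A : Matrix ι κ T) (V : Matrix μ ι T)
    (i₀ : ι) (j₀ : κ) (r₀ : μ) (hA : A i₀ j₀ ≠ 0) (hV : V r₀ i₀ = 1)
    (hp : ∀ r i j, A i j * V r i ∈ R) (hs : ∀ r i j, A i₀ j * V r i + A i j * V r i₀ ∈ R) :
    (∀ i j, IsAlgebraic R (A i j)) ∧ ∀ r i, IsAlgebraic R (V r i) := by
  have mem {x : T} (hx : x ∈ R) : IsAlgebraic R x := isAlgebraic_algebraMap (⟨x, hx⟩ : R)
  have hA₀ (j) : A i₀ j ∈ R := by simpa [hV] using hp r₀ i₀ j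
  -- The ratio `z = V r₀ i` solves `p z² - s z + q = 0`, where `p = A i₀ j₀`, `q = A i j₀ * z` and
  -- `s = p z + A i j₀`: it is one of the two roots of a binary quadratic form.
  have hV₀ (i) : IsAlgebraic R (V r₀ i) := by
    refine isAlgebraic_of_quadratic (p := ⟨A i₀ j₀, hA₀ j₀⟩) (s := ⟨_, hs r₀ i j₀⟩)
      (q := ⟨_, hp r₀ i j₀⟩) (by simpa [Subtype.ext_iff] using hA) ?_
    simp only [Subalgebra.algebraMap_apply, hV]
    ring
  have hA' (i j) : IsAlgebraic R (A i j) := by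
    have := (mem (hs r₀ i j)).sub ((mem (hA₀ j)).mul (hV₀ i))
    simpa [hV] using this
  have hcancel {x : T} (hx : IsAlgebraic R (A i₀ j₀ * x)) : IsAlgebraic R x :=
    .of_mul (mem_nonZeroDivisors_of_ne_zero hA) (mem (hA₀ j₀)) hx
  have hV' (r) : IsAlgebraic R (V r i₀) := hcancel (mem (hp r i₀ j₀))
  refine ⟨hA', fun r i => hcancel ?_⟩
  simpa using (mem (hs r i j₀)).sub ((hA' i j₀).mul (hV' r))

/-- The solution of a nonsingular linear system with algebraic coefficients is algebraic, by Cramer's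
rule. -/
theorem isAlgebraic_of_mulVec {k T : Type*} [Field k] [CommRing T] [IsDomain T] [Algebra k T]
    (R : Subalgebra k T) {ι : Type*} [Fintype ι] [DecidableEq ι] (M : Matrix ι ι T) (v : ι → T)
    (hdet : M.det ≠ 0) (hM : ∀ i j, IsAlgebraic R (M i j)) (hv : ∀ i, IsAlgebraic R ((M *ᵥ v) i))
    (i : ι) : IsAlgebraic R (v i) := by
  set C := Subalgebra.algebraicClosure R T
  let N : Matrix ι ι C := of fun i j => ⟨M i j, hM i j⟩
  have hN : M = N.map C.val := rfl
  have hadj : M.adjugate = N.adjugate.map C.val := by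
    rw [hN]; exact (C.val.map_adjugate N).symm
  have hd : M.det = (N.det : T) := by rw [hN]; exact (C.val.map_det N).symm
  refine .of_mul (mem_nonZeroDivisors_of_ne_zero hdet) (hd ▸ N.det.2) ?_
  have h : M.det * v i = ∑ j, M.adjugate i j * (M *ᵥ v) j := by
    have := congrFun (Matrix.mulVec_mulVec v M.adjugate M) i
    rw [Matrix.adjugate_mul, Matrix.smul_mulVec, Matrix.one_mulVec] at this
    simpa [mulVec, dotProduct] using this.symm
  rw [h]
  exact Subalgebra.sum_mem C fun j _ => C.mul_mem (hadj ▸ (N.adjugate i j).2) (hv j)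

/-! ### The neuromanifold as the image of a bilinear map -/

variable {d d' a t : ℕ}

/-- The point of the neuromanifold with given weights. -/
def neuromanifoldPoint (t : ℕ) (Q K : Matrix (Fin a) (Fin d) ℝ) (V : Matrix (Fin d') (Fin d) ℝ) :
    neuromanifold d d' a t :=
  ⟨⟨mechanism Q K V, mechanism_mem Q K V⟩, (Q, K, V), rfl⟩

theorem neuromanifoldPoint_surjective (x : neuromanifold d d' a t) :
    ∃ Q K V, x = neuromanifoldPoint t Q K V := by
  obtain ⟨_, ⟨Q, K, V⟩, rfl⟩ := x
  exact ⟨Q, K, V, rfl⟩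

/-- The mechanism depends on the weights only through `Kᵀ * Q` and `V`, and a scalar can be moved
from the one to the other; the inner dimension `a` plays no role. -/
theorem mechanism_eq_of_mul_eq {a₁ a₂ : ℕ} {Q₁ K₁ : Matrix (Fin a₁) (Fin d) ℝ}
    {Q₂ K₂ : Matrix (Fin a₂) (Fin d) ℝ} {V₁ V₂ : Matrix (Fin d') (Fin d) ℝ} {c : ℝ}
    (hA : K₂ᵀ * Q₂ = c • (K₁ᵀ * Q₁)) (hV : V₁ = c • V₂) :
    (mechanism Q₂ K₂ V₂ : Matrix (Fin d) (Fin t) ℝ → Matrix (Fin d') (Fin t) ℝ) =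
      mechanism Q₁ K₁ V₁ := by
  ext X r i
  simp only [mechanism, hA, hV, Matrix.smul_mulVec, dotProduct_smul, Matrix.of_apply,
    Pi.smul_apply, smul_eq_mul]
  exact Finset.sum_congr rfl fun j _ => by ring

/-- The mechanism in which `Kᵀ * Q` and `V` are the matrix units at the positions `s.1` and `s.2`.
One row of queries and keys is enough for it. -/
def basicMap (d d' t : ℕ) (s : (Fin d × Fin d) × (Fin d' × Fin d)) : homogeneousMaps 3 d d' t :=
  ⟨mechanism (a := 1) (single 0 s.1.2 1) (single 0 s.1.1 1) (single s.2.1 s.2.2 1),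
    mechanism_mem _ _ _⟩

theorem basicMap_apply (s : (Fin d × Fin d) × (Fin d' × Fin d)) (X : Matrix (Fin d) (Fin t) ℝ)
    (r : Fin d') (i : Fin t) :
    (basicMap d d' t s).1 X r i =
      ∑ j, X s.1.1 j * X s.1.2 i * if r = s.2.1 then X s.2.2 j else 0 := by
  simp only [basicMap, mechanism, Matrix.of_apply]
  refine Finset.sum_congr rfl fun j _ => ?_
  congr 1
  · simp [Matrix.transpose_single, Matrix.single_mul_single_same, Matrix.single_mulVec, dotProduct,
      Function.update_apply]
  · simp [Matrix.single_mulVec, Function.update_apply]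

/-- The mechanism is bilinear in `Kᵀ * Q` and `V`. -/
theorem neuromanifoldPoint_eq_sum (Q K : Matrix (Fin a) (Fin d) ℝ) (V : Matrix (Fin d') (Fin d) ℝ) :
    (neuromanifoldPoint t Q K V : homogeneousMaps 3 d d' t) =
      ∑ s : (Fin d × Fin d) × (Fin d' × Fin d),
        ((Kᵀ * Q) s.1.1 s.1.2 * V s.2.1 s.2.2) • basicMap d d' t s := by
  apply Subtype.ext
  ext X r i
  have h : (((∑ s : (Fin d × Fin d) × (Fin d' × Fin d),
      ((Kᵀ * Q) s.1.1 s.1.2 * V s.2.1 s.2.2) • basicMap d d' t s : homogeneousMaps 3 d d' t)) :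
      Matrix (Fin d) (Fin t) ℝ → Matrix (Fin d') (Fin t) ℝ) X r i =
      ∑ s : (Fin d × Fin d) × (Fin d' × Fin d),
        ((Kᵀ * Q) s.1.1 s.1.2 * V s.2.1 s.2.2) * (basicMap d d' t s).1 X r i := by
    simp [Finset.sum_apply, Matrix.sum_apply]
  rw [h]
  simp only [basicMap_apply, neuromanifoldPoint, mechanism, Matrix.of_apply, Finset.mul_sum]
  rw [Finset.sum_comm]
  refine Finset.sum_congr rfl fun j _ => ?_
  simp only [dotProduct, mulVec, Matrix.col_apply, Fintype.sum_prod_type, Finset.mul_sum,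
    Finset.sum_mul, mul_ite, mul_zero, Finset.sum_ite_irrel, Finset.sum_const_zero,
    Finset.sum_ite_eq, Finset.mem_univ, if_true]
  rw [Finset.sum_comm]
  refine Finset.sum_congr rfl fun k _ => ?_
  rw [Finset.sum_comm]
  refine Finset.sum_congr rfl fun l _ => ?_
  refine Finset.sum_congr rfl fun m _ => ?_
  ring

/-- The restrictions of the linear forms to the neuromanifold span a finite-dimensional space of
functions, since the neuromanifold lies in the span of the maps `basicMap`. This makes the coordinate
ring finitely generated. -/
theorem finiteType_coordinateRing :
    Algebra.FiniteType ℝ (coordinateRing (neuromanifold d d' a t)) := by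
  let f : Module.Dual ℝ (homogeneousMaps 3 d d' t) →ₗ[ℝ] (neuromanifold d d' a t → ℝ) :=
    LinearMap.pi fun s => LinearMap.applyₗ (s : homogeneousMaps 3 d d' t)
  choose Q K V hx using neuromanifoldPoint_surjective (d := d) (d' := d') (a := a) (t := t)
  -- The coefficient functions depend on a choice of weights for each point, so they need not lie in
  -- the coordinate ring; only the finite dimension of their span is used.
  let b (s : (Fin d × Fin d) × (Fin d' × Fin d)) (x : neuromanifold d d' a t) : ℝ :=
    ((K x)ᵀ * Q x) s.1.1 s.1.2 * V x s.2.1 s.2.2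
  have hle : LinearMap.range f ≤ Submodule.span ℝ (Set.range b) := by
    rintro _ ⟨l, rfl⟩
    rw [Submodule.mem_span_range_iff_exists_fun]
    refine ⟨fun s => l (basicMap d d' t s), funext fun x => ?_⟩
    have : f l x = l (neuromanifoldPoint t (Q x) (K x) (V x) : homogeneousMaps 3 d d' t) := by
      rw [← hx]; rfl
    rw [this, neuromanifoldPoint_eq_sum]
    simp [b, mul_comm]
  have : FiniteDimensional ℝ (Submodule.span ℝ (Set.range b)) :=
    FiniteDimensional.span_of_finite ℝ (Set.finite_range b)
  have hfin : FiniteDimensional ℝ (LinearMap.range f) := Submodule.finiteDimensional_of_le hle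
  obtain ⟨u, hu⟩ := (Submodule.fg_iff_finiteDimensional _).2 hfin
  rw [← Subalgebra.fg_iff_finiteType]
  refine ⟨u, ?_⟩
  rw [← Algebra.adjoin_span, hu]
  rfl

/-! ### Pullback along polynomial families of weights -/

/-- A regular function becomes polynomial when the weights are polynomials in parameters `w`. -/
theorem exists_polynomial_of_mem_coordinateRing {τ : Type*}
    (Q K : Matrix (Fin a) (Fin d) (MvPolynomial τ ℝ))
    (V : Matrix (Fin d') (Fin d) (MvPolynomial τ ℝ))
    {f : neuromanifold d d' a t → ℝ} (hf : f ∈ coordinateRing (neuromanifold d d' a t)) :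
    ∃ p : MvPolynomial τ ℝ, ∀ w : τ → ℝ, MvPolynomial.eval w p =
      f (neuromanifoldPoint t (Q.map (MvPolynomial.eval w)) (K.map (MvPolynomial.eval w))
        (V.map (MvPolynomial.eval w))) := by
  induction hf using Algebra.adjoin_induction with
  | mem f hf =>
    obtain ⟨l, rfl⟩ := hf
    refine ⟨∑ s : (Fin d × Fin d) × (Fin d' × Fin d),
      (Kᵀ * Q) s.1.1 s.1.2 * V s.2.1 s.2.2 * MvPolynomial.C (l (basicMap d d' t s)), fun w => ?_⟩
    simp only [neuromanifoldPoint_eq_sum, map_sum, map_smul, map_mul, MvPolynomial.eval_C,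
      smul_eq_mul, Matrix.map_apply, Matrix.mul_apply, Matrix.transpose_apply]
  | algebraMap r => exact ⟨MvPolynomial.C r, fun w => by simp⟩
  | add f g _ _ hf hg =>
    obtain ⟨p, hp⟩ := hf
    obtain ⟨q, hq⟩ := hg
    exact ⟨p + q, fun w => by simp [hp, hq]⟩
  | mul f g _ _ hf hg =>
    obtain ⟨p, hp⟩ := hf
    obtain ⟨q, hq⟩ := hg
    exact ⟨p * q, fun w => by simp [hp, hq]⟩

/-- Weights that are polynomials in parameters `w` pull regular functions on the neuromanifold back
to polynomials in `w`. -/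
theorem exists_pullback {τ : Type*}
    (Q K : Matrix (Fin a) (Fin d) (MvPolynomial τ ℝ))
    (V : Matrix (Fin d') (Fin d) (MvPolynomial τ ℝ)) :
    ∃ ψ : coordinateRing (neuromanifold d d' a t) →ₐ[ℝ] MvPolynomial τ ℝ,
      ∀ f w, MvPolynomial.eval w (ψ f) =
      f.1 (neuromanifoldPoint t (Q.map (MvPolynomial.eval w)) (K.map (MvPolynomial.eval w))
        (V.map (MvPolynomial.eval w))) := by
  choose p hp using fun f : coordinateRing (neuromanifold d d' a t) =>
    exists_polynomial_of_mem_coordinateRing Q K V f.2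
  exact ⟨{ toFun := p
           map_one' := MvPolynomial.funext fun w => by simp [hp]
           map_zero' := MvPolynomial.funext fun w => by simp [hp]
           map_mul' := fun f g => MvPolynomial.funext fun w => by simp [hp]
           map_add' := fun f g => MvPolynomial.funext fun w => by simp [hp]
           commutes' := fun r => MvPolynomial.funext fun w => by simp [hp] }, hp⟩

/-! ### Linear forms given by two tokens -/

/-- The input whose first token is `x`, whose second token is `y`, and whose other tokens vanish. -/
def twoTokens (t : ℕ) (x y : Fin d → ℝ) : Matrix (Fin d) (Fin t) ℝ :=
  of fun k j => if (j : ℕ) = 0 then x k else if (j : ℕ) = 1 then y k else 0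

theorem mechanism_twoTokens (ht : 2 ≤ t) (Q K : Matrix (Fin a) (Fin d) ℝ)
    (V : Matrix (Fin d') (Fin d) ℝ) (x y : Fin d → ℝ) (r : Fin d') :
    mechanism Q K V (twoTokens t x y) r ⟨0, by lia⟩ =
      (x ⬝ᵥ (Kᵀ * Q) *ᵥ x) * (V *ᵥ x) r + (y ⬝ᵥ (Kᵀ * Q) *ᵥ x) * (V *ᵥ y) r := by
  obtain ⟨t, rfl⟩ := Nat.exists_eq_add_of_le' ht
  have h0 : (twoTokens (t + 2) x y).col ⟨0, by lia⟩ = x := by ext; simp [twoTokens]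
  have h1 : (twoTokens (t + 2) x y).col 1 = y := by ext; simp [twoTokens]
  have h2 (j : Fin t) : (twoTokens (t + 2) x y).col j.succ.succ = 0 := by ext; simp [twoTokens]
  simp only [mechanism, of_apply, h0]
  rw [Fin.sum_univ_succ, Fin.sum_univ_succ]
  simp only [h2, zero_dotProduct, zero_mul, Finset.sum_const_zero, add_zero]
  congr 2

/-- The linear form on cubical maps that takes the `r`-th entry of the first output token at
`(x, y, 0, …)` and removes the contribution of the token `x` to itself. On a mechanism it isolates
the contribution of `y`. -/
def tokenForm (ht : 2 ≤ t) (x y : Fin d → ℝ) (r : Fin d') :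
    Module.Dual ℝ (homogeneousMaps 3 d d' t) where
  toFun f := f.1 (twoTokens t x y) r ⟨0, by lia⟩ - f.1 (twoTokens t x 0) r ⟨0, by lia⟩
  map_add' f g := by simp; ring
  map_smul' c f := by simp; ring

theorem tokenForm_neuromanifoldPoint (ht : 2 ≤ t) (Q K : Matrix (Fin a) (Fin d) ℝ)
    (V : Matrix (Fin d') (Fin d) ℝ) (x y : Fin d → ℝ) (r : Fin d') :
    tokenForm ht x y r (neuromanifoldPoint t Q K V : homogeneousMaps 3 d d' t) =
      (y ⬝ᵥ (Kᵀ * Q) *ᵥ x) * (V *ᵥ y) r := by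
  simp [tokenForm, neuromanifoldPoint, mechanism_twoTokens ht]

/-- The form with `x = e_l` and `y = e_k` pulls back to a product of entries of `Kᵀ * Q` and `V`. -/
theorem mul_mem_range_pullback (ht : 2 ≤ t) {τ : Type*}
    {Q K : Matrix (Fin a) (Fin d) (MvPolynomial τ ℝ)}
    {V : Matrix (Fin d') (Fin d) (MvPolynomial τ ℝ)}
    {ψ : coordinateRing (neuromanifold d d' a t) →ₐ[ℝ] MvPolynomial τ ℝ}
    (hψ : ∀ f w, MvPolynomial.eval w (ψ f) =
      f.1 (neuromanifoldPoint t (Q.map (MvPolynomial.eval w)) (K.map (MvPolynomial.eval w))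
        (V.map (MvPolynomial.eval w)))) (r : Fin d') (k l : Fin d) :
    (Kᵀ * Q) k l * V r k ∈ ψ.range := by
  refine ⟨⟨_, Algebra.subset_adjoin ⟨tokenForm ht (Pi.single l 1) (Pi.single k 1) r, rfl⟩⟩,
    MvPolynomial.funext fun w => ?_⟩
  refine (hψ _ w).trans ?_
  simp only [tokenForm_neuromanifoldPoint]
  simp [Matrix.mul_apply]

/-- The polarization of `mul_mem_range_pullback`, from the form with `x = e_l` and
`y = e_{k₀} + e_k`. -/
theorem mul_add_mul_mem_range_pullback (ht : 2 ≤ t) {τ : Type*}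
    {Q K : Matrix (Fin a) (Fin d) (MvPolynomial τ ℝ)}
    {V : Matrix (Fin d') (Fin d) (MvPolynomial τ ℝ)}
    {ψ : coordinateRing (neuromanifold d d' a t) →ₐ[ℝ] MvPolynomial τ ℝ}
    (hψ : ∀ f w, MvPolynomial.eval w (ψ f) =
      f.1 (neuromanifoldPoint t (Q.map (MvPolynomial.eval w)) (K.map (MvPolynomial.eval w))
        (V.map (MvPolynomial.eval w)))) (r : Fin d') (k₀ k l : Fin d) :
    (Kᵀ * Q) k₀ l * V r k + (Kᵀ * Q) k l * V r k₀ ∈ ψ.range := by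
  have h : ((Kᵀ * Q) k₀ l + (Kᵀ * Q) k l) * (V r k₀ + V r k) ∈ ψ.range := by
    refine ⟨⟨_, Algebra.subset_adjoin ⟨tokenForm ht (Pi.single l 1)
      (Pi.single k₀ 1 + Pi.single k 1) r, rfl⟩⟩, MvPolynomial.funext fun w => ?_⟩
    refine (hψ _ w).trans ?_
    simp only [tokenForm_neuromanifoldPoint]
    simp [Matrix.mul_apply, Matrix.mulVec_add]
  have := sub_mem (sub_mem h (mul_mem_range_pullback ht hψ r k₀ l))
    (mul_mem_range_pullback ht hψ r k l)
  convert this using 1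
  ring

/-! ### The slice of normalized weights -/

/-- The parameters of the slice for inner dimension `a ≤ d`: all entries of `K`, the entries of `Q`
outside its first `a` columns, and the entries of `V` other than the one at `p₀`. -/
abbrev SliceVar (d d' a : ℕ) (p₀ : Fin d' × Fin d) : Type :=
  (Fin a × Fin d) ⊕ (Fin a × {l : Fin d // a ≤ l}) ⊕ {p : Fin d' × Fin d // p ≠ p₀}

theorem card_sliceVar (had : a ≤ d) (p₀ : Fin d' × Fin d) :
    Nat.card (SliceVar d d' a p₀) = 2 * a * d + d * d' - a ^ 2 - 1 := by
  have h1 : Fintype.card {l : Fin d // a ≤ l} = d - a := by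
    rw [Fintype.card_subtype]
    have := Fin.card_filter_val_lt (n := d) (m := a)
    have h2 := Finset.card_filter_add_card_filter_not
      (s := (Finset.univ : Finset (Fin d))) (fun l => (l : ℕ) < a)
    simp only [not_lt, Finset.card_univ, Fintype.card_fin] at h2
    lia
  have h2 : 0 < d' * d := by simpa using Fintype.card_pos_iff.2 ⟨p₀⟩
  rw [Nat.card_eq_fintype_card]
  simp only [Fintype.card_sum, Fintype.card_prod, Fintype.card_fin, h1,
    Fintype.card_subtype_compl, Fintype.card_unique, ne_eq]
  obtain ⟨b, rfl⟩ := Nat.exists_eq_add_of_le had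
  have : 2 * a * (a + b) + (a + b) * d' = a * (a + b) + a * b + d' * (a + b) + a ^ 2 := by ring
  rw [this, Nat.add_sub_cancel_left]
  lia

open MvPolynomial

/-- The generic key matrix. -/
noncomputable def sliceKey (a : ℕ) (p₀ : Fin d' × Fin d) :
    Matrix (Fin a) (Fin d) (MvPolynomial (SliceVar d d' a p₀) ℝ) :=
  of fun c k => X (.inl (c, k))

/-- The generic query matrix of the form `[1 | *]`. -/
noncomputable def sliceQuery (a : ℕ) (p₀ : Fin d' × Fin d) :
    Matrix (Fin a) (Fin d) (MvPolynomial (SliceVar d d' a p₀) ℝ) :=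
  of fun c l => if h : a ≤ l then X (.inr (.inl (c, ⟨l, h⟩))) else if (l : ℕ) = c then 1 else 0

/-- The generic value matrix whose entry at `p₀` is `1`. -/
noncomputable def sliceValue (a : ℕ) (p₀ : Fin d' × Fin d) :
    Matrix (Fin d') (Fin d) (MvPolynomial (SliceVar d d' a p₀) ℝ) :=
  of fun r k => if h : (r, k) ≠ p₀ then X (.inr (.inr ⟨(r, k), h⟩)) else 1

/-- The attention matrix `Kᵀ Q` at the generic point of the slice. -/
noncomputable def sliceAttention (a : ℕ) (p₀ : Fin d' × Fin d) :
    Matrix (Fin d) (Fin d) (MvPolynomial (SliceVar d d' a p₀) ℝ) :=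
  (sliceKey a p₀)ᵀ * sliceQuery a p₀

theorem sliceAttention_castLE (had : a ≤ d) (p₀ : Fin d' × Fin d) (k : Fin d) (c : Fin a) :
    sliceAttention a p₀ k (Fin.castLE had c) = sliceKey a p₀ c k := by
  simp only [sliceAttention, mul_apply, transpose_apply]
  rw [Finset.sum_eq_single c]
  · simp [sliceQuery, c.2.not_ge]
  · intro b _ hb
    simp [sliceQuery, c.2.not_ge, Fin.val_inj, Ne.symm hb]
  · simp

/-- The parameters of the slice are algebraic over the coordinate ring. For `A = Kᵀ * Q` and `V` this
is `isAlgebraic_of_mul_mem`; the first `a` columns of `A` form `Kᵀ`, and the remaining columns of `Q`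
solve a linear system whose matrix is the generic `a × a` block of `Kᵀ`. -/
theorem isAlgebraic_slice (had : a ≤ d) (ha : 0 < a) (r₀ : Fin d') (k₀ : Fin d)
    (R : Subalgebra ℝ (MvPolynomial (SliceVar d d' a (r₀, k₀)) ℝ))
    (hp : ∀ r k l, sliceAttention a (r₀, k₀) k l *
      sliceValue a (r₀, k₀) r k ∈ R)
    (hs : ∀ r k l, sliceAttention a (r₀, k₀) k₀ l *
      sliceValue a (r₀, k₀) r k + sliceAttention a (r₀, k₀) k l *
      sliceValue a (r₀, k₀) r k₀ ∈ R) :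
    Algebra.IsAlgebraic R (MvPolynomial (SliceVar d d' a (r₀, k₀)) ℝ) := by
  obtain ⟨hA, hV⟩ := isAlgebraic_of_mul_mem R _ (sliceValue a (r₀, k₀)) k₀
    (Fin.castLE had ⟨0, ha⟩) r₀ (by rw [sliceAttention_castLE]; exact X_ne_zero _)
    (by simp [sliceValue]) hp hs
  have hK (c k) : IsAlgebraic R (sliceKey a (r₀, k₀) c k) :=
    sliceAttention_castLE had (r₀, k₀) k c ▸ hA _ _
  let M : Matrix (Fin a) (Fin a) (MvPolynomial (SliceVar d d' a (r₀, k₀)) ℝ) :=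
    ((sliceKey a (r₀, k₀)).submatrix id (Fin.castLE had))ᵀ
  -- The determinant of the generic block is nonzero because it is `1` at the identity.
  have hM : M.det ≠ 0 := by
    intro h
    let w : SliceVar d d' a (r₀, k₀) → ℝ :=
      Sum.elim (fun p => if (p.1 : ℕ) = p.2 then 1 else 0) 0
    have h1 : M.map (eval w) = 1 := by
      ext i j
      simp [M, sliceKey, w, Matrix.one_apply, Fin.val_inj, eq_comm]
    have h2 := (eval w).map_det M
    rw [h, map_zero] at h2
    have : (eval w).mapMatrix M = 1 := h1
    simp [this] at h2
  have hQ (c l) : IsAlgebraic R (sliceQuery a (r₀, k₀) c l) := by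
    refine isAlgebraic_of_mulVec R M (fun c => sliceQuery a (r₀, k₀) c l) hM (fun i j => hK _ _)
      (fun i => ?_) c
    exact hA (Fin.castLE had i) l
  have hX (v) : IsAlgebraic R (X v : MvPolynomial (SliceVar d d' a (r₀, k₀)) ℝ) := by
    rcases v with ⟨c, k⟩ | ⟨c, l, hl⟩ | ⟨⟨r, k⟩, h⟩
    · exact hK c k
    · simpa [sliceQuery, hl] using hQ c l
    · simpa only [sliceValue, of_apply, dif_pos h] using hV r k
  refine ⟨fun p => ?_⟩
  induction p using MvPolynomial.induction_on with
  | C c => exact isAlgebraic_algebraMap (algebraMap ℝ R c)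
  | add p q hp hq => exact hp.add hq
  | mul_X p v hp => exact hp.mul (hX v)

/-- Generic weights can be moved into the slice without changing the mechanism: multiplication of `Q`
by `G⁻¹` and of `K` by `Gᵀ`, with `G` the first `a × a` block of `Q`, preserves `Kᵀ * Q`, and the entry
`V p₀.1 p₀.2` is scaled to `1` at the expense of `K`. -/
theorem exists_slice_point (had : a ≤ d) (p₀ : Fin d' × Fin d) (Q K : Matrix (Fin a) (Fin d) ℝ)
    (V : Matrix (Fin d') (Fin d) ℝ) (hQ : (Q.submatrix id (Fin.castLE had)).det ≠ 0)
    (hV : V p₀.1 p₀.2 ≠ 0) :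
    ∃ w, neuromanifoldPoint t ((sliceQuery a p₀).map (eval w)) ((sliceKey a p₀).map (eval w))
      ((sliceValue a p₀).map (eval w)) = neuromanifoldPoint t Q K V := by
  set G := Q.submatrix id (Fin.castLE had) with hG
  have hGu : IsUnit G.det := hQ.isUnit
  let w : SliceVar d d' a p₀ → ℝ :=
    Sum.elim (fun p => (V p₀.1 p₀.2 • (Gᵀ * K)) p.1 p.2)
      (Sum.elim (fun p => (G⁻¹ * Q) p.1 p.2) fun p => (V p₀.1 p₀.2)⁻¹ * V p.1.1 p.1.2)
  have h1 : (sliceQuery a p₀).map (eval w) = G⁻¹ * Q := by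
    ext c l
    by_cases h : a ≤ l
    · simp [sliceQuery, h, w]
    · have hone : (G⁻¹ * Q) c l = (G⁻¹ * G) c ⟨l, not_le.1 h⟩ := by
        simp [mul_apply, hG]
      rw [hone, nonsing_inv_mul _ hGu]
      simp only [sliceQuery, map_apply, of_apply, dif_neg h, one_apply, Fin.ext_iff]
      split_ifs <;> first | lia | simp
  have h2 : (sliceKey a p₀).map (eval w) = V p₀.1 p₀.2 • (Gᵀ * K) := by
    ext c k
    simp [sliceKey, w]
  have h3 : (sliceValue a p₀).map (eval w) = (V p₀.1 p₀.2)⁻¹ • V := by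
    ext r k
    by_cases h : (r, k) = p₀
    · subst h
      simp [sliceValue, hV]
    · simp [sliceValue, h, w]
  refine ⟨w, Subtype.ext (Subtype.ext ?_)⟩
  refine mechanism_eq_of_mul_eq (c := V p₀.1 p₀.2) ?_ ?_
  · rw [h1, h2, transpose_smul, transpose_mul, transpose_transpose, smul_mul, Matrix.mul_assoc,
      mul_nonsing_inv_cancel_left _ _ hGu]
  · rw [h3, smul_inv_smul₀ hV]

/-- The slice is dense in the neuromanifold for the Zariski topology: the pullback to all weights of a
function that vanishes on the slice becomes zero after multiplication with a nonzero polynomial. -/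
theorem slice_pullback_injective (had : a ≤ d) (p₀ : Fin d' × Fin d)
    {ψ : coordinateRing (neuromanifold d d' a t) →ₐ[ℝ] MvPolynomial (SliceVar d d' a p₀) ℝ}
    (hψ : ∀ f w, eval w (ψ f) = f.1 (neuromanifoldPoint t ((sliceQuery a p₀).map (eval w))
      ((sliceKey a p₀).map (eval w)) ((sliceValue a p₀).map (eval w)))) :
    Function.Injective ψ := by
  rw [injective_iff_map_eq_zero]
  intro f hf
  let τ := (Fin a × Fin d) ⊕ (Fin a × Fin d) ⊕ (Fin d' × Fin d)
  let Q : Matrix (Fin a) (Fin d) (MvPolynomial τ ℝ) := of fun c k => X (.inl (c, k))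
  let K : Matrix (Fin a) (Fin d) (MvPolynomial τ ℝ) := of fun c k => X (.inr (.inl (c, k)))
  let V : Matrix (Fin d') (Fin d) (MvPolynomial τ ℝ) := of fun r k => X (.inr (.inr (r, k)))
  let w (Q' K' : Matrix (Fin a) (Fin d) ℝ) (V' : Matrix (Fin d') (Fin d) ℝ) : τ → ℝ :=
    Sum.elim (fun p => Q' p.1 p.2) (Sum.elim (fun p => K' p.1 p.2) fun p => V' p.1 p.2)
  obtain ⟨φ, hφ⟩ := exists_pullback (t := t) Q K V
  have hdet (v) : eval v (Q.submatrix id (Fin.castLE had)).det =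
      ((Q.map (eval v)).submatrix id (Fin.castLE had)).det := (eval v).map_det _
  have hzero : φ f * ((Q.submatrix id (Fin.castLE had)).det * V p₀.1 p₀.2) = 0 := by
    refine MvPolynomial.funext fun v => ?_
    simp only [map_mul, map_zero, hdet]
    by_contra! hne
    simp only [mul_ne_zero_iff] at hne
    obtain ⟨h1, h2, h3⟩ := hne
    obtain ⟨w', hw'⟩ := exists_slice_point (t := t) had p₀ (Q.map (eval v)) (K.map (eval v))
      (V.map (eval v)) h2 h3
    rw [hφ, ← hw', ← hψ, hf] at h1
    simp at h1
  have hne : (Q.submatrix id (Fin.castLE had)).det * V p₀.1 p₀.2 ≠ 0 := by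
    refine mul_ne_zero (fun h => ?_) (X_ne_zero _)
    have h1 := hdet (w (of fun c l => if (c : ℕ) = l then 1 else 0) 0 0)
    have h2 : (Q.map (eval (w (of fun c l => if (c : ℕ) = l then 1 else 0) 0 0))).submatrix id
        (Fin.castLE had) = 1 := by
      ext i j
      simp [Q, w, one_apply, Fin.val_inj]
    rw [h, h2] at h1
    simp at h1
  have hφf : φ f = 0 := (mul_eq_zero.1 hzero).resolve_right hne
  refine Subtype.ext (_root_.funext fun x => ?_)
  obtain ⟨Q', K', V', rfl⟩ := neuromanifoldPoint_surjective x
  have h1 := hφ f (w Q' K' V')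
  have hQ' : Q.map (eval (w Q' K' V')) = Q' := by ext; simp [Q, w]
  have hK' : K.map (eval (w Q' K' V')) = K' := by ext; simp [K, w]
  have hV' : V.map (eval (w Q' K' V')) = V' := by ext; simp [V, w]
  rw [hφf, hQ', hK', hV', map_zero] at h1
  exact h1.symm

theorem dimension_neuromanifold_of_le (hd' : 0 < d') (ha : 0 < a) (ht : 2 ≤ t) (had : a ≤ d) :
    dimension (neuromanifold d d' a t) =
      ((2 * a * d + d * d' - a ^ 2 - 1 : ℕ) : WithBot ℕ∞) := by
  let r₀ : Fin d' := ⟨0, hd'⟩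
  let k₀ : Fin d := ⟨0, ha.trans_le had⟩
  obtain ⟨ψ, hψ⟩ := exists_pullback (t := t) (sliceQuery a (r₀, k₀)) (sliceKey a (r₀, k₀))
    (sliceValue a (r₀, k₀))
  let e := AlgEquiv.ofInjective ψ (slice_pullback_injective had _ hψ)
  have : Algebra.FiniteType ℝ ψ.range := finiteType_coordinateRing.equiv e
  have := isAlgebraic_slice had ha r₀ k₀ ψ.range (mul_mem_range_pullback ht hψ)
    (fun r => mul_add_mul_mem_range_pullback ht hψ r k₀)
  rw [dimension, ringKrullDim_eq_of_ringEquiv e.toRingEquiv, ringKrullDim_eq_card_of_isAlgebraic,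
    card_sliceVar had]

/-- For `d ≤ a`, the matrix `Kᵀ * Q` is an arbitrary `d × d` matrix. -/
theorem neuromanifold_eq_of_le (hda : d ≤ a) :
    neuromanifold d d' a t = neuromanifold d d' d t := by
  have key {a₁ a₂ : ℕ} {Q₁ K₁ : Matrix (Fin a₁) (Fin d) ℝ} {Q₂ K₂ : Matrix (Fin a₂) (Fin d) ℝ}
      (V : Matrix (Fin d') (Fin d) ℝ) (h : K₂ᵀ * Q₂ = K₁ᵀ * Q₁) :
      (neuromanifoldPoint t Q₂ K₂ V : homogeneousMaps 3 d d' t) = neuromanifoldPoint t Q₁ K₁ V :=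
    Subtype.ext (mechanism_eq_of_mul_eq (c := 1) (by simp [h]) (by simp))
  apply Set.Subset.antisymm
  · rintro _ ⟨⟨Q, K, V⟩, rfl⟩
    exact ⟨(Kᵀ * Q, 1, V), key V (by simp)⟩
  · rintro _ ⟨⟨Q, K, V⟩, rfl⟩
    -- `J` is an isometric embedding, so it does not change `Kᵀ * Q`.
    let J : Matrix (Fin a) (Fin d) ℝ := of fun i j => if i = Fin.castLE hda j then 1 else 0
    have hJ : Jᵀ * J = 1 := by
      ext i j
      simp [J, mul_apply, one_apply, eq_comm]
    refine ⟨(J * Q, J * K, V), key V ?_⟩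
    rw [transpose_mul, Matrix.mul_assoc, ← Matrix.mul_assoc Jᵀ, hJ, Matrix.one_mul]

end LightningAttention

/-- The subtractions of natural numbers below do not truncate: `a ^ 2 ≤ a * d` if `a ≤ d`, and
`1 ≤ a * d`, `1 ≤ d ^ 2`. -/
theorem mainTheorem5 (d d' a t : ℕ) (hd : 0 < d) (hd' : 0 < d') (ha : 0 < a) (ht : 2 ≤ t)
    (h : (2 ≤ d ∧ 2 ≤ d') ∨ (2 ≤ d ∧ 2 ≤ a)) :
    LightningAttention.dimension (LightningAttention.neuromanifold d d' a t) =
      ((if a ≤ d then 2 * a * d + d * d' - a ^ 2 - 1 else d ^ 2 + d * d' - 1 : ℕ) :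
        WithBot ℕ∞) := by
  split_ifs with had
  · exact LightningAttention.dimension_neuromanifold_of_le hd' ha ht had
  · rw [LightningAttention.neuromanifold_eq_of_le (not_le.1 had).le,
      LightningAttention.dimension_neuromanifold_of_le hd' hd ht le_rfl]
    congr 2
    have : 2 * d * d = d ^ 2 + d ^ 2 := by ring
    lia
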